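/- Let $\mathbb{T}^2=\mathbb{R}^2/\mathbb{Z}^2$ be the square flat torus with its geodesic distance $\|x-y\|$. For $p>0$ and $x_1,x_2,x_3\in\mathbb{T}^2$ let $$E_p(x_1,x_2,x_3)=\frac{1}{\|x_1-x_2\|^p}+\frac{1}{\|x_1-x_3\|^p}+\frac{1}{\|x_2-x_3\|^p}\in(0,\infty],$$ with value $\infty$ if two of the points coincide. A global minimizer of $E_p$ is a triple that minimizes $E_p$ over $(\mathbb{T}^2)^3$; triples are compared up to symmetries, that is, relabelings of the points and isometries of $\mathbb{T}^2$. Let $$T_3=\left\{(0,0),\ \left(\tfrac12,\tfrac{2-\sqrt3}{2}\right),\ \left(\tfrac{2-\sqrt3}{2},\tfrac12\right)\right\}.$$ Then $T_3$ maximizes the minimal distance $\min_{i\neq j}\|x_i-x_j\|$ among all triples of points in $\mathbb{T}^2$, and a global minimizer of $E_p$ exists for every $p>0$. Moreover: (i) As $p\to\infty$, every global minimizer is close to $T_3$: for every $\varepsilon>0$ there is $p_0>0$ such that for all $p\ge p_0$ every global minimizer of $E_p$ is, point by point, at distance less than $\varepsilon$ from a copy of $T_3$ under the symmetries. (ii)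 For every $p>0$, every global minimizer of $E_p$ is distinct from $T_3$, also up to symmetries. (iii) Each triple can only be optimal for $p$ in a bounded interval: for every $(x_1,x_2,x_3)$ there is $P$ such that $(x_1,x_2,x_3)$ is not a global minimizer of $E_p$ for any $p>0$ with $p>P$. (iv) As $p$ varies over $(0,\infty)$, there are infinitely many distinct global minimizers, even up to symmetries. -/

import Mathlib

open scoped ENNReal

/-- The square flat torus `ℝ² / ℤ²`: the product of two circles `ℝ / ℤ`, each of length one, with
the `ℓ²` product metric. Its distance is the geodesic distance of the flat torus, i.e. the
Euclidean distance of two points of `ℝ²` minimized over their translates by `ℤ²`. -/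
abbrev FlatTorus : Type := PiLp 2 (fun _ : Fin 2 => UnitAddCircle)

namespace FlatTorus

/-- The point of the flat torus with coordinates `(a, b)` modulo one. -/
def point (a b : ℝ) : FlatTorus :=
  WithLp.toLp 2 ![(a : UnitAddCircle), (b : UnitAddCircle)]

/-- Configurations of three (labelled) points on the flat torus. -/
abbrev Config : Type := Fin 3 → FlatTorus

/-- The Riesz `p`-energy `1/‖x₁ - x₂‖ᵖ + 1/‖x₁ - x₃‖ᵖ + 1/‖x₂ - x₃‖ᵖ`, with values in `[0, ∞]`:
for `p > 0` it is infinite exactly if two of the points coincide. -/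
noncomputable def rieszEnergy (p : ℝ) (x : Config) : ℝ≥0∞ :=
  1 / edist (x 0) (x 1) ^ p + 1 / edist (x 0) (x 2) ^ p + 1 / edist (x 1) (x 2) ^ p

/-- `x` is a global minimizer of the Riesz `p`-energy over all triples of points. -/
def IsGlobalMinimizer (p : ℝ) (x : Config) : Prop :=
  ∀ y : Config, rieszEnergy p x ≤ rieszEnergy p y

/-- The smallest of the three pairwise distances of a configuration. -/
noncomputable def minDistance (x : Config) : ℝ :=
  min (dist (x 0) (x 1)) (min (dist (x 0) (x 2)) (dist (x 1) (x 2)))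

/-- Two configurations agree up to the symmetries of the problem: the relabelings of the points
and the isometries of the flat torus. -/
def SymmEquiv (x y : Config) : Prop :=
  ∃ (g : FlatTorus ≃ᵢ FlatTorus) (σ : Equiv.Perm (Fin 3)), ∀ i, y i = g (x (σ i))

theorem symmEquiv_equivalence : Equivalence SymmEquiv where
  refl x := ⟨IsometryEquiv.refl _, Equiv.refl _, fun _ => rfl⟩
  symm := by
    rintro x y ⟨g, σ, h⟩
    refine ⟨g.symm, σ.symm, fun i => ?_⟩
    rw [h, Equiv.apply_symm_apply, IsometryEquiv.symm_apply_apply]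
  trans := by
    rintro x y z ⟨g, σ, h⟩ ⟨g', σ', h'⟩
    refine ⟨g.trans g', σ'.trans σ, fun i => ?_⟩
    rw [h', h, IsometryEquiv.trans_apply, Equiv.trans_apply]

/-- The equivalence relation of agreeing up to symmetries. -/
def symmSetoid : Setoid Config := ⟨SymmEquiv, symmEquiv_equivalence⟩

/-- The configuration `T₃ = {(0, 0), (1/2, (2 - √3)/2), ((2 - √3)/2, 1/2)}`. -/
noncomputable def T3 : Config :=
  ![point 0 0, point (1 / 2) ((2 - √3) / 2), point ((2 - √3) / 2) (1 / 2)]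

end FlatTorus

/-!
The torus distance satisfies `‖x‖² = ‖x₀‖² + ‖x₁‖²` with the distances of the circle `ℝ / ℤ` in
the two coordinates. For three points let `a₁, a₂, a₃` and `b₁, b₂, b₃` be their pairwise distances
in the first and in the second coordinate. All of them are at most `1 / 2`, and three points of a
circle of length one have perimeter at most one (`dist_add_dist_add_dist_le_one`).

The side of `T3` has the square `2 c` with `c = (2 - √3) / 2`, and `2 c = (1 / 2)² + c²`. If all
pairwise distances are at least that long, then all `aᵢ` and `bᵢ` lie in `[c, 1 / 2]`. By
majorization, `∑ aᵢ²` is then at most `(1 / 2)² + (1 / 2 - c)² + c² = 3 c`, with equality only for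
permutations of `(1 / 2, 1 / 2 - c, c)`, and likewise for `b`. As the two sums add up to at least
`6 c`, equality holds in both, and the way the two permutations fit together is forced
(`coordinate_rigidity`). So `T3` maximizes the minimal distance and is, up to symmetries, the only
maximizer (`symmEquiv_T3_of_le_minDistance`).

The statements on minimizers follow. They exist since the energy is continuous with values in
`[0, ∞]` and the torus is compact. A configuration with minimal distance at most `m` has energy at
least `m⁻ᵖ`, and for `m` less than the side of `T3` this exceeds the energy of `T3` once `p` is
large (`exists_forall_not_isGlobalMinimizer`); with compactness and uniqueness of `T3`, minimizers
approach `T3`. But `T3` itself is never a minimizer: it is not a critical point of the energy within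
the family `{(0, 0), (1 / 2, s), (s, 1 / 2)}` (`not_isGlobalMinimizer_T3`). So every configuration
is a minimizer for a bounded set of exponents only, and no finite number of classes can serve all
exponents (`infinite_minimizers`).
-/

namespace FlatTorus

/-! ### Distances on the circle -/

theorem exists_real_rep (a : UnitAddCircle) : ∃ r : ℝ, (r : UnitAddCircle) = a ∧ |r| = ‖a‖ := by
  induction a using QuotientAddGroup.induction_on with
  | H x =>
    refine ⟨x - round x, ?_, UnitAddCircle.norm_eq.symm⟩
    rw [AddCircle.coe_sub, sub_eq_self]
    exact (AddCircle.coe_eq_zero_iff 1).2 ⟨round x, by simp⟩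

theorem norm_coe_le_abs_sub_intCast (r : ℝ) (n : ℤ) : ‖(r : UnitAddCircle)‖ ≤ |r - n| := by
  rw [UnitAddCircle.norm_eq]
  exact round_le r n

theorem norm_coe_of_abs_le {r : ℝ} (h : |r| ≤ 1 / 2) : ‖(r : UnitAddCircle)‖ = |r| :=
  (AddCircle.norm_coe_eq_abs_iff 1 one_ne_zero).2 (by simpa using h)

theorem dist_circle_le_half (a b : UnitAddCircle) : dist a b ≤ 1 / 2 := by
  rw [dist_eq_norm]
  simpa using AddCircle.norm_le_half_period (1 : ℝ) (x := a - b) one_ne_zero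

theorem coe_half_neg : -((1 / 2 : ℝ) : UnitAddCircle) = ((1 / 2 : ℝ) : UnitAddCircle) := by
  rw [neg_eq_iff_add_eq_zero, ← AddCircle.coe_add]
  exact (AddCircle.coe_eq_zero_iff 1).2 ⟨1, by norm_num⟩

theorem eq_add_units_smul_of_dist_eq {a b : UnitAddCircle} {r : ℝ} (h : dist b a = r) :
    ∃ s : ℤˣ, b = a + s • (r : UnitAddCircle) := by
  obtain ⟨t, ht, ht'⟩ := exists_real_rep (b - a)
  rw [← dist_eq_norm, h] at ht'
  have hb : b = a + (t : UnitAddCircle) := by rw [ht]; abel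
  rcases abs_choice t with h0 | h0
  · exact ⟨1, by rw [hb, one_smul, ← ht', h0]⟩
  · exact ⟨-1, by rw [hb, ← ht', h0, Units.neg_smul, one_smul, AddCircle.coe_neg, neg_neg]⟩

/-- Three points of a circle of length one have perimeter at most one: if they do not cut the
circle into three arcs of length at most `1 / 2`, they lie on an arc of length at most `1 / 2`. -/
theorem dist_add_dist_add_dist_le_one (a b c : UnitAddCircle) :
    dist a b + dist a c + dist b c ≤ 1 := by
  obtain ⟨r, hr, hr'⟩ := exists_real_rep (a - b)
  obtain ⟨s, hs, hs'⟩ := exists_real_rep (b - c)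
  have hab := dist_circle_le_half a b
  have hbc := dist_circle_le_half b c
  have hac : dist a c = ‖((r + s : ℝ) : UnitAddCircle)‖ := by
    rw [AddCircle.coe_add, hr, hs, dist_eq_norm]; congr 1; abel
  have h0 := norm_coe_le_abs_sub_intCast (r + s) 0
  have h1 := norm_coe_le_abs_sub_intCast (r + s) 1
  have h2 := norm_coe_le_abs_sub_intCast (r + s) (-1)
  push_cast at h0 h1 h2
  rw [← dist_eq_norm] at hr' hs'
  rw [hac]
  rw [← hr'] at hab ⊢
  rw [← hs'] at hbc ⊢
  generalize ‖((r + s : ℝ) : UnitAddCircle)‖ = t at *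
  rcases abs_cases r with ⟨e1, _⟩ | ⟨e1, _⟩ <;> rcases abs_cases s with ⟨e2, _⟩ | ⟨e2, _⟩ <;>
    rw [e1] at hab ⊢ <;> rw [e2] at hbc ⊢
  · rw [abs_of_nonpos (by linarith)] at h1; linarith
  · rcases abs_cases (r + s - 0) with ⟨e3, _⟩ | ⟨e3, _⟩ <;> linarith
  · rcases abs_cases (r + s - 0) with ⟨e3, _⟩ | ⟨e3, _⟩ <;> linarith
  · rw [abs_of_nonneg (by linarith)] at h2; linarith

/-! ### The extremal problem for coordinate distances -/

/-- If `c ≤ a₃ ≤ a₂ ≤ a₁ ≤ 1 / 2` and `a₁ + a₂ + a₃ ≤ 1`, then `(a₁, a₂, a₃)` is weakly majorized by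
`(1 / 2, 1 / 2 - c, c)`; so it has the smaller sum of squares, strictly unless the two agree. -/
theorem eq_of_sum_sq_ge_of_sorted {c a₁ a₂ a₃ : ℝ} (hc : 0 < c) (hc' : c < 1 / 4)
    (h₁ : a₁ ≤ 1 / 2) (h₃ : c ≤ a₃) (h₁₂ : a₂ ≤ a₁) (h₂₃ : a₃ ≤ a₂) (hs : a₁ + a₂ + a₃ ≤ 1) :
    a₁ ^ 2 + a₂ ^ 2 + a₃ ^ 2 ≤ 1 / 2 - c + 2 * c ^ 2 ∧
      (1 / 2 - c + 2 * c ^ 2 ≤ a₁ ^ 2 + a₂ ^ 2 + a₃ ^ 2 → a₁ = 1 / 2 ∧ a₂ = 1 / 2 - c ∧ a₃ = c) := by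
  -- Abel summation of `∑ (tᵢ - aᵢ) (tᵢ + aᵢ)` for `t = (1 / 2, 1 / 2 - c, c)`
  have key : 1 / 2 - c + 2 * c ^ 2 - (a₁ ^ 2 + a₂ ^ 2 + a₃ ^ 2) =
      (1 / 2 - a₁) * (c + (a₁ - a₂)) + (1 - c - (a₁ + a₂)) * ((1 / 2 - 2 * c) + (a₂ - a₃)) +
        (1 - (a₁ + a₂ + a₃)) * (c + a₃) := by ring
  have p₁ : 0 ≤ (1 / 2 - a₁) * (c + (a₁ - a₂)) := mul_nonneg (by linarith) (by linarith)
  have p₂ : 0 ≤ (1 - c - (a₁ + a₂)) * ((1 / 2 - 2 * c) + (a₂ - a₃)) :=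
    mul_nonneg (by linarith) (by linarith)
  have p₃ : 0 ≤ (1 - (a₁ + a₂ + a₃)) * (c + a₃) := mul_nonneg (by linarith) (by linarith)
  refine ⟨by linarith, fun h => ?_⟩
  have e₁ : 1 / 2 - a₁ = 0 :=
    (mul_eq_zero.1 (le_antisymm (by linarith) p₁)).resolve_right (by linarith)
  have e₂ : 1 - c - (a₁ + a₂) = 0 :=
    (mul_eq_zero.1 (le_antisymm (by linarith) p₂)).resolve_right (by linarith)
  have e₃ : 1 - (a₁ + a₂ + a₃) = 0 :=
    (mul_eq_zero.1 (le_antisymm (by linarith) p₃)).resolve_right (by linarith)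
  exact ⟨by linarith, by linarith, by linarith⟩

/-- The triple `(a₁, a₂, a₃)` is a permutation of `(1 / 2, 1 / 2 - c, c)`. -/
def IsExtremal (c a₁ a₂ a₃ : ℝ) : Prop :=
  (a₁ = 1 / 2 ∧ a₂ = 1 / 2 - c ∧ a₃ = c) ∨ (a₁ = 1 / 2 ∧ a₃ = 1 / 2 - c ∧ a₂ = c) ∨
  (a₂ = 1 / 2 ∧ a₁ = 1 / 2 - c ∧ a₃ = c) ∨ (a₂ = 1 / 2 ∧ a₃ = 1 / 2 - c ∧ a₁ = c) ∨
  (a₃ = 1 / 2 ∧ a₁ = 1 / 2 - c ∧ a₂ = c) ∨ (a₃ = 1 / 2 ∧ a₂ = 1 / 2 - c ∧ a₁ = c)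

theorem isExtremal_of_sum_sq_ge {c a₁ a₂ a₃ : ℝ} (hc : 0 < c) (hc' : c < 1 / 4)
    (u₁ : a₁ ≤ 1 / 2) (u₂ : a₂ ≤ 1 / 2) (u₃ : a₃ ≤ 1 / 2) (l₁ : c ≤ a₁) (l₂ : c ≤ a₂) (l₃ : c ≤ a₃)
    (hs : a₁ + a₂ + a₃ ≤ 1) :
    a₁ ^ 2 + a₂ ^ 2 + a₃ ^ 2 ≤ 1 / 2 - c + 2 * c ^ 2 ∧
      (1 / 2 - c + 2 * c ^ 2 ≤ a₁ ^ 2 + a₂ ^ 2 + a₃ ^ 2 → IsExtremal c a₁ a₂ a₃) := by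
  unfold IsExtremal
  rcases le_total a₁ a₂ with h | h <;> rcases le_total a₁ a₃ with h' | h' <;>
    rcases le_total a₂ a₃ with h'' | h''
  · have := eq_of_sum_sq_ge_of_sorted hc hc' u₃ l₁ h'' h (by linarith)
    exact ⟨by linarith, fun H => Or.inr (Or.inr (Or.inr (Or.inr (Or.inr (this.2 (by linarith))))))⟩
  · have := eq_of_sum_sq_ge_of_sorted hc hc' u₂ l₁ h'' h' (by linarith)
    exact ⟨by linarith, fun H => Or.inr (Or.inr (Or.inr (Or.inl (this.2 (by linarith)))))⟩
  · have := eq_of_sum_sq_ge_of_sorted hc hc' u₃ l₁ h'' h (by linarith)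
    exact ⟨by linarith, fun H => Or.inr (Or.inr (Or.inr (Or.inr (Or.inr (this.2 (by linarith))))))⟩
  · have := eq_of_sum_sq_ge_of_sorted hc hc' u₂ l₃ h h' (by linarith)
    exact ⟨by linarith, fun H => Or.inr (Or.inr (Or.inl (this.2 (by linarith))))⟩
  · have := eq_of_sum_sq_ge_of_sorted hc hc' u₃ l₂ h' h (by linarith)
    exact ⟨by linarith, fun H => Or.inr (Or.inr (Or.inr (Or.inr (Or.inl (this.2 (by linarith))))))⟩
  · have := eq_of_sum_sq_ge_of_sorted hc hc' u₁ l₂ (by linarith) (by linarith) (by linarith)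
    exact ⟨by linarith, fun H => by
      have := this.2 (by linarith)
      exact absurd this.1 (by linarith)⟩
  · have := eq_of_sum_sq_ge_of_sorted hc hc' u₁ l₂ h' h'' (by linarith)
    exact ⟨by linarith, fun H => Or.inr (Or.inl (this.2 (by linarith)))⟩
  · have := eq_of_sum_sq_ge_of_sorted hc hc' u₁ l₃ h h'' (by linarith)
    exact ⟨by linarith, fun H => Or.inl (this.2 (by linarith))⟩

/-- For `c = (2 - √3) / 2`, the smaller root of `c² = 2 c - 1 / 4`, two triples of coordinate
distances with `2 c ≤ aᵢ² + bᵢ²` are extremal, and `aᵢ = c` goes along with `bᵢ = 1 / 2`. -/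
theorem coordinate_rigidity {c a₁ a₂ a₃ b₁ b₂ b₃ : ℝ} (hc : 0 < c) (hc' : c < 1 / 4)
    (hcc : c ^ 2 = 2 * c - 1 / 4)
    (na₁ : 0 ≤ a₁) (na₂ : 0 ≤ a₂) (na₃ : 0 ≤ a₃) (nb₁ : 0 ≤ b₁) (nb₂ : 0 ≤ b₂) (nb₃ : 0 ≤ b₃)
    (ua₁ : a₁ ≤ 1 / 2) (ua₂ : a₂ ≤ 1 / 2) (ua₃ : a₃ ≤ 1 / 2)
    (ub₁ : b₁ ≤ 1 / 2) (ub₂ : b₂ ≤ 1 / 2) (ub₃ : b₃ ≤ 1 / 2)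
    (ha : a₁ + a₂ + a₃ ≤ 1) (hb : b₁ + b₂ + b₃ ≤ 1)
    (h₁ : 2 * c ≤ a₁ ^ 2 + b₁ ^ 2) (h₂ : 2 * c ≤ a₂ ^ 2 + b₂ ^ 2) (h₃ : 2 * c ≤ a₃ ^ 2 + b₃ ^ 2) :
    (a₁ = 1 / 2 ∧ b₁ = c ∧ a₂ = c ∧ b₂ = 1 / 2) ∨ (a₂ = 1 / 2 ∧ b₂ = c ∧ a₁ = c ∧ b₁ = 1 / 2) ∨
    (a₁ = 1 / 2 ∧ b₁ = c ∧ a₃ = c ∧ b₃ = 1 / 2) ∨ (a₃ = 1 / 2 ∧ b₃ = c ∧ a₁ = c ∧ b₁ = 1 / 2) ∨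
    (a₂ = 1 / 2 ∧ b₂ = c ∧ a₃ = c ∧ b₃ = 1 / 2) ∨ (a₃ = 1 / 2 ∧ b₃ = c ∧ a₂ = c ∧ b₂ = 1 / 2) := by
  -- since `2 c = (1 / 2)² + c²`, no coordinate distance is below `c`
  have low : ∀ a b : ℝ, 0 ≤ a → 0 ≤ b → b ≤ 1 / 2 → 2 * c ≤ a ^ 2 + b ^ 2 → c ≤ a := by
    intro a b h0 hb0 hb1 hab
    have := pow_le_pow_left₀ hb0 hb1 2
    exact le_of_sq_le_sq (by linarith) h0
  have A := isExtremal_of_sum_sq_ge hc hc' ua₁ ua₂ ua₃ (low _ _ na₁ nb₁ ub₁ h₁)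
    (low _ _ na₂ nb₂ ub₂ h₂) (low _ _ na₃ nb₃ ub₃ h₃) ha
  have B := isExtremal_of_sum_sq_ge hc hc' ub₁ ub₂ ub₃ (low _ _ nb₁ na₁ ua₁ (by linarith))
    (low _ _ nb₂ na₂ ua₂ (by linarith)) (low _ _ nb₃ na₃ ua₃ (by linarith)) hb
  have A' := A.2 (by linarith [B.1])
  have B' := B.2 (by linarith [A.1])
  -- a coordinate distance `c` forces the other one to be `1 / 2`
  have high : ∀ b : ℝ, 0 ≤ b → 2 * c ≤ c ^ 2 + b ^ 2 → 1 / 2 ≤ b := by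
    intro b h0 hb
    exact le_of_sq_le_sq (by linarith) h0
  clear A B ha hb
  have k₁ : a₁ = c → 1 / 2 ≤ b₁ := fun h => high _ nb₁ (h ▸ h₁)
  have k₂ : a₂ = c → 1 / 2 ≤ b₂ := fun h => high _ nb₂ (h ▸ h₂)
  have k₃ : a₃ = c → 1 / 2 ≤ b₃ := fun h => high _ nb₃ (h ▸ h₃)
  have l₁ : b₁ = c → 1 / 2 ≤ a₁ := fun h => high _ na₁ (by rw [h] at h₁; linarith)
  have l₂ : b₂ = c → 1 / 2 ≤ a₂ := fun h => high _ na₂ (by rw [h] at h₂; linarith)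
  have l₃ : b₃ = c → 1 / 2 ≤ a₃ := fun h => high _ na₃ (by rw [h] at h₃; linarith)
  clear low high h₁ h₂ h₃ hcc
  rcases A' with ⟨x, y, z⟩ | ⟨x, y, z⟩ | ⟨x, y, z⟩ | ⟨x, y, z⟩ | ⟨x, y, z⟩ | ⟨x, y, z⟩ <;>
    rcases B' with ⟨x', y', z'⟩ | ⟨x', y', z'⟩ | ⟨x', y', z'⟩ | ⟨x', y', z'⟩ | ⟨x', y', z'⟩ |
      ⟨x', y', z'⟩ <;> grind

/-! ### The configuration `T3` -/

theorem dist_sq_eq (x y : FlatTorus) :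
    dist x y ^ 2 = dist (x 0) (y 0) ^ 2 + dist (x 1) (y 1) ^ 2 := by
  rw [PiLp.dist_eq_of_L2, Real.sq_sqrt (by positivity), Fin.sum_univ_two]

theorem dist_point_sq {a b a' b' : ℝ} (ha : |a - a'| ≤ 1 / 2) (hb : |b - b'| ≤ 1 / 2) :
    dist (point a b) (point a' b') ^ 2 = (a - a') ^ 2 + (b - b') ^ 2 := by
  rw [dist_sq_eq]
  simp only [point, Matrix.cons_val_zero, Matrix.cons_val_one]
  rw [dist_eq_norm, dist_eq_norm, ← AddCircle.coe_sub, ← AddCircle.coe_sub, norm_coe_of_abs_le ha,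
    norm_coe_of_abs_le hb, sq_abs, sq_abs]

/-- The isosceles configuration `{(0, 0), (1 / 2, s), (s, 1 / 2)}`. -/
noncomputable def isosceles (s : ℝ) : Config := ![point 0 0, point (1 / 2) s, point s (1 / 2)]

theorem dist_isosceles {s : ℝ} (h0 : 0 ≤ s) (h1 : s ≤ 1 / 2) :
    dist (isosceles s 0) (isosceles s 1) = √(1 / 4 + s ^ 2) ∧
    dist (isosceles s 0) (isosceles s 2) = √(1 / 4 + s ^ 2) ∧
    dist (isosceles s 1) (isosceles s 2) = √(2 * (1 / 2 - s) ^ 2) := by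
  refine ⟨?_, ?_, ?_⟩ <;> symm <;> rw [Real.sqrt_eq_iff_eq_sq (by positivity) dist_nonneg] <;>
    simp only [isosceles, Matrix.cons_val_zero, Matrix.cons_val_one, Matrix.cons_val] <;>
    rw [dist_point_sq (abs_le.2 ⟨by linarith, by linarith⟩) (abs_le.2 ⟨by linarith, by linarith⟩)] <;>
    ring

/-- The parameter `(2 - √3) / 2` of the configuration `T3`. -/
noncomputable def c₃ : ℝ := (2 - √3) / 2

theorem c₃_sq : c₃ ^ 2 = 2 * c₃ - 1 / 4 := by
  have := Real.sq_sqrt (show (0 : ℝ) ≤ 3 by norm_num)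
  unfold c₃; linarith

theorem c₃_lt : c₃ < 1 / 4 := by
  have : (3 / 2 : ℝ) < √3 := Real.lt_sqrt_of_sq_lt (by norm_num)
  unfold c₃; linarith

theorem lt_c₃ : 1 / 8 < c₃ := by
  have := c₃_sq
  nlinarith [sq_nonneg (c₃ - 1 / 8), c₃_lt]

theorem T3_eq : T3 = isosceles c₃ := rfl

theorem dist_T3 : dist (T3 0) (T3 1) = √(2 * c₃) ∧ dist (T3 0) (T3 2) = √(2 * c₃) ∧
    dist (T3 1) (T3 2) = √(2 * c₃) := by
  have h := dist_isosceles (by linarith [lt_c₃]) (by linarith [c₃_lt] : c₃ ≤ 1 / 2)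
  rw [← T3_eq] at h
  refine ⟨h.1.trans ?_, h.2.1.trans ?_, h.2.2.trans ?_⟩ <;> congr 1 <;> linarith [c₃_sq]

theorem minDistance_T3 : minDistance T3 = √(2 * c₃) := by
  simp [minDistance, dist_T3.1, dist_T3.2.1, dist_T3.2.2]

/-- The isometry of the flat torus that applies `±1` and then a translation in each coordinate. -/
noncomputable def reflectTranslate (t : FlatTorus) (s : Fin 2 → ℤˣ) : FlatTorus ≃ᵢ FlatTorus where
  toFun p := WithLp.toLp 2 fun i => t i + s i • p i
  invFun p := WithLp.toLp 2 fun i => (s i)⁻¹ • (p i - t i)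
  left_inv p := by
    ext i
    simp only [add_sub_cancel_left, inv_smul_smul]
  right_inv p := by
    ext i
    simp only [smul_inv_smul, add_sub_cancel]
  isometry_toFun := Isometry.of_dist_eq fun x y => by
    have h : ∀ (u : ℤˣ) (a b : UnitAddCircle), dist (u • a) (u • b) = dist a b := by
      intro u a b
      rcases Int.units_eq_one_or u with rfl | rfl <;> simp
    simp only [PiLp.dist_eq_of_L2, dist_add_left, h]

/-- A configuration whose coordinate distances to one of its points are those of `T3` to the
origin is a copy of `T3`: each coordinate is determined up to translation and reflection. -/
theorem symmEquiv_T3_of_coordinates {x : Config} (σ : Equiv.Perm (Fin 3))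
    (h₁ : dist (x (σ 1) 0) (x (σ 0) 0) = 1 / 2) (h₁' : dist (x (σ 1) 1) (x (σ 0) 1) = c₃)
    (h₂ : dist (x (σ 2) 0) (x (σ 0) 0) = c₃) (h₂' : dist (x (σ 2) 1) (x (σ 0) 1) = 1 / 2) :
    SymmEquiv T3 x := by
  have half : ∀ s s' : ℤˣ,
      s • ((1 / 2 : ℝ) : UnitAddCircle) = s' • ((1 / 2 : ℝ) : UnitAddCircle) := by
    intro s s'
    rcases Int.units_eq_one_or s with rfl | rfl <;>
      rcases Int.units_eq_one_or s' with rfl | rfl <;>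
      simp only [Units.neg_smul, one_smul, coe_half_neg]
  obtain ⟨s, hs⟩ := eq_add_units_smul_of_dist_eq h₁
  obtain ⟨s₁, hs₁⟩ := eq_add_units_smul_of_dist_eq h₁'
  obtain ⟨s₀, hs₀⟩ := eq_add_units_smul_of_dist_eq h₂
  obtain ⟨s', hs'⟩ := eq_add_units_smul_of_dist_eq h₂'
  -- `1 / 2 = -1 / 2` on the circle, so the signs can be read off from the coordinates `± c₃`
  rw [half s s₀] at hs
  rw [half s' s₁] at hs'
  have key : ∀ i, x (σ i) = reflectTranslate (x (σ 0)) ![s₀, s₁] (T3 i) := by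
    intro i
    ext j
    fin_cases i <;> fin_cases j <;>
      simp [reflectTranslate, T3, point] <;> first
        | assumption
        | simpa using hs
        | simpa using hs'
  exact ⟨reflectTranslate (x (σ 0)) ![s₀, s₁], σ.symm, fun i => by
    rw [← key, Equiv.apply_symm_apply]⟩

/-- Up to symmetries, `T3` is the only configuration of minimal distance at least `√(2 c₃)`. -/
theorem symmEquiv_T3_of_le_minDistance {x : Config} (h : √(2 * c₃) ≤ minDistance x) :
    SymmEquiv T3 x := by
  have sq : ∀ i j, √(2 * c₃) ≤ dist (x i) (x j) →
      2 * c₃ ≤ dist (x i 0) (x j 0) ^ 2 + dist (x i 1) (x j 1) ^ 2 := by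
    intro i j hij
    rw [← dist_sq_eq]
    exact (Real.sqrt_le_left dist_nonneg).1 hij
  unfold minDistance at h
  rw [le_min_iff, le_min_iff] at h
  obtain ⟨h₁, h₂, h₃⟩ := h
  have := coordinate_rigidity (by linarith [lt_c₃]) c₃_lt c₃_sq
    dist_nonneg dist_nonneg dist_nonneg dist_nonneg dist_nonneg dist_nonneg
    (dist_circle_le_half _ _) (dist_circle_le_half _ _) (dist_circle_le_half _ _)
    (dist_circle_le_half _ _) (dist_circle_le_half _ _) (dist_circle_le_half _ _)
    (dist_add_dist_add_dist_le_one (x 0 0) (x 1 0) (x 2 0))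
    (dist_add_dist_add_dist_le_one (x 0 1) (x 1 1) (x 2 1))
    (sq _ _ h₁) (sq _ _ h₂) (sq _ _ h₃)
  rcases this with ⟨p, q, r, s⟩ | ⟨p, q, r, s⟩ | ⟨p, q, r, s⟩ | ⟨p, q, r, s⟩ | ⟨p, q, r, s⟩ |
    ⟨p, q, r, s⟩
  · exact symmEquiv_T3_of_coordinates 1 (by rwa [dist_comm]) (by rwa [dist_comm])
      (by rwa [dist_comm]) (by rwa [dist_comm])
  · refine symmEquiv_T3_of_coordinates (Equiv.swap 1 2) ?_ ?_ ?_ ?_ <;> rw [dist_comm] <;> assumption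
  · refine symmEquiv_T3_of_coordinates (Equiv.swap 0 1) ?_ ?_ ?_ ?_ <;>
      first | assumption | (rw [dist_comm]; assumption)
  · refine symmEquiv_T3_of_coordinates (Equiv.swap 0 1 * Equiv.swap 1 2) ?_ ?_ ?_ ?_ <;>
      first | assumption | (rw [dist_comm]; assumption)
  · exact symmEquiv_T3_of_coordinates (Equiv.swap 0 2 * Equiv.swap 1 2) (by assumption) (by assumption)
      (by assumption) (by assumption)
  · exact symmEquiv_T3_of_coordinates (Equiv.swap 0 2) (by assumption) (by assumption)
      (by assumption) (by assumption)

/-! ### Energies of configurations -/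

instance : CompactSpace FlatTorus :=
  ⟨by
    have h := isCompact_range (PiLp.continuous_toLp 2 (fun _ : Fin 2 => UnitAddCircle))
    rwa [(WithLp.toLp_surjective 2).range_eq] at h⟩

theorem perm_fin_three (σ : Equiv.Perm (Fin 3)) :
    (σ 0 = 0 ∧ σ 1 = 1 ∧ σ 2 = 2) ∨ (σ 0 = 0 ∧ σ 1 = 2 ∧ σ 2 = 1) ∨
    (σ 0 = 1 ∧ σ 1 = 0 ∧ σ 2 = 2) ∨ (σ 0 = 1 ∧ σ 1 = 2 ∧ σ 2 = 0) ∨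
    (σ 0 = 2 ∧ σ 1 = 0 ∧ σ 2 = 1) ∨ (σ 0 = 2 ∧ σ 1 = 1 ∧ σ 2 = 0) := by
  revert σ; decide

theorem rieszEnergy_symmEquiv {x y : Config} (h : SymmEquiv x y) (p : ℝ) :
    rieszEnergy p y = rieszEnergy p x := by
  obtain ⟨g, σ, h⟩ := h
  simp only [rieszEnergy, h, g.isometry.edist_eq]
  rcases perm_fin_three σ with ⟨a, b, c⟩ | ⟨a, b, c⟩ | ⟨a, b, c⟩ | ⟨a, b, c⟩ | ⟨a, b, c⟩ |
    ⟨a, b, c⟩ <;> rw [a, b, c]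
  · rw [edist_comm (x 2) (x 1)]; abel
  · rw [edist_comm (x 1) (x 0)]; abel
  · rw [edist_comm (x 1) (x 0), edist_comm (x 2) (x 0)]; abel
  · rw [edist_comm (x 2) (x 0), edist_comm (x 2) (x 1)]; abel
  · rw [edist_comm (x 2) (x 1), edist_comm (x 2) (x 0), edist_comm (x 1) (x 0)]; abel

theorem IsGlobalMinimizer.of_symmEquiv {x y : Config} {p : ℝ} (h : SymmEquiv x y)
    (hy : IsGlobalMinimizer p y) : IsGlobalMinimizer p x := fun z => by
  rw [← rieszEnergy_symmEquiv h]; exact hy z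

theorem continuous_rieszEnergy (p : ℝ) : Continuous (rieszEnergy p) := by
  have h : ∀ i j : Fin 3, Continuous fun x : Config => 1 / edist (x i) (x j) ^ p := by
    intro i j
    simp only [one_div]
    exact (ENNReal.continuous_rpow_const.comp
      ((continuous_apply i).edist (continuous_apply j))).inv
  exact ((h 0 1).add (h 0 2)).add (h 1 2)

theorem exists_isGlobalMinimizer (p : ℝ) : ∃ x : Config, IsGlobalMinimizer p x := by
  obtain ⟨x, -, hx⟩ := isCompact_univ.exists_isMinOn (Set.univ_nonempty (α := Config))
    (continuous_rieszEnergy p).continuousOn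
  exact ⟨x, fun y => hx (Set.mem_univ y)⟩

theorem continuous_minDistance : Continuous minDistance :=
  ((continuous_apply 0).dist (continuous_apply 1)).min
    (((continuous_apply 0).dist (continuous_apply 2)).min
      ((continuous_apply 1).dist (continuous_apply 2)))

theorem one_div_edist_rpow {x y : FlatTorus} {q : ℝ} (hq : 0 < q) (h : dist x y = √q) (p : ℝ) :
    1 / edist x y ^ p = ENNReal.ofReal (q ^ (-p / 2)) := by
  rw [edist_dist, h, ENNReal.ofReal_rpow_of_pos (Real.sqrt_pos.2 hq), one_div,
    ← ENNReal.ofReal_inv_of_pos (by positivity), ← Real.rpow_neg (Real.sqrt_nonneg q),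
    Real.sqrt_eq_rpow, ← Real.rpow_mul hq.le]
  congr 2; ring

theorem rieszEnergy_isosceles {s : ℝ} (h0 : 0 < s) (h1 : s < 1 / 2) (p : ℝ) :
    rieszEnergy p (isosceles s) = ENNReal.ofReal
      (2 * (1 / 4 + s ^ 2) ^ (-p / 2) + (2 * (1 / 2 - s) ^ 2) ^ (-p / 2)) := by
  obtain ⟨e₁, e₂, e₃⟩ := dist_isosceles h0.le h1.le
  have q : 0 < 2 * (1 / 2 - s) ^ 2 := mul_pos two_pos (pow_pos (by linarith) 2)
  rw [rieszEnergy, one_div_edist_rpow (by positivity) e₁, one_div_edist_rpow (by positivity) e₂,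
    one_div_edist_rpow q e₃, ← ENNReal.ofReal_add (by positivity) (by positivity),
    ← ENNReal.ofReal_add (by positivity) (by positivity), two_mul (_ ^ (-p / 2))]

/-! ### Global minimizers -/

/-- `T3` is not even critical within the isosceles configurations: the two equal sides have
squared length `1 / 4 + s²`, the third one `2 (1 / 2 - s)²`, and at `s = c₃`, where all sides are
equal, the sum of the squared lengths has the derivative `8 c₃ - 2 ≠ 0`. -/
theorem not_isGlobalMinimizer_T3 {p : ℝ} (hp : 0 < p) : ¬ IsGlobalMinimizer p T3 := by
  intro h
  have hc := c₃_lt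
  have hc' := lt_c₃
  set f : ℝ → ℝ := fun s => 2 * (1 / 4 + s ^ 2) ^ (-p / 2) + (2 * (1 / 2 - s) ^ 2) ^ (-p / 2)
    with hf
  have hmin : IsLocalMin f c₃ := by
    filter_upwards [Ioo_mem_nhds (a := 0) (b := 1 / 2) (by linarith : (0 : ℝ) < c₃) (by linarith)]
      with s hs
    have := h (isosceles s)
    rw [T3_eq, rieszEnergy_isosceles (by linarith) (by linarith),
      rieszEnergy_isosceles hs.1 hs.2] at this
    have h0 : 0 ≤ f s := by positivity
    exact (ENNReal.ofReal_le_ofReal_iff h0).1 this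
  have e₁ : 1 / 4 + c₃ ^ 2 = 2 * c₃ := by linarith [c₃_sq]
  have e₂ : 2 * (1 / 2 - c₃) ^ 2 = 2 * c₃ := by linarith [c₃_sq]
  have d₁ : HasDerivAt (fun s : ℝ => 1 / 4 + s ^ 2) (2 * c₃) c₃ := by
    simpa using (hasDerivAt_pow 2 c₃).const_add (1 / 4)
  have d₂ : HasDerivAt (fun s : ℝ => 2 * (1 / 2 - s) ^ 2) (2 * (2 * (1 / 2 - c₃) * (-1))) c₃ := by
    exact ((((hasDerivAt_id c₃).const_sub (1 / 2)).pow 2).const_mul 2).congr_deriv (by simp)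
  have d := ((d₁.rpow_const (p := -p / 2) (Or.inl (by rw [e₁]; linarith))).const_mul 2).add
    (d₂.rpow_const (p := -p / 2) (Or.inl (by rw [e₂]; linarith)))
  have z := hmin.hasDerivAt_eq_zero d
  rw [e₁, e₂] at z
  have pos : 0 < (2 * c₃) ^ (-p / 2 - 1) := Real.rpow_pos_of_pos (by linarith) _
  have z' : (p * (2 * c₃) ^ (-p / 2 - 1)) * (1 - 4 * c₃) = 0 := by linarith
  have : 0 < p * (2 * c₃) ^ (-p / 2 - 1) := by positivity
  have := (mul_eq_zero.1 z').resolve_left this.ne'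
  linarith

theorem rieszEnergy_T3 (p : ℝ) :
    rieszEnergy p T3 = ENNReal.ofReal (3 * (√(2 * c₃)) ^ (-p)) := by
  have e₁ : 1 / 4 + c₃ ^ 2 = 2 * c₃ := by linarith [c₃_sq]
  have e₂ : 2 * (1 / 2 - c₃) ^ 2 = 2 * c₃ := by linarith [c₃_sq]
  have h : 0 ≤ 2 * c₃ := by linarith [lt_c₃]
  rw [T3_eq, rieszEnergy_isosceles (by linarith [lt_c₃]) (by linarith [c₃_lt]), e₁, e₂,
    Real.sqrt_eq_rpow, ← Real.rpow_mul h, show 1 / 2 * -p = -p / 2 by ring]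
  congr 1; ring

theorem le_rieszEnergy {p m : ℝ} (hp : 0 < p) (hm : 0 < m) {x : Config} (h : minDistance x ≤ m) :
    ENNReal.ofReal (m ^ (-p)) ≤ rieszEnergy p x := by
  have key : ∀ i j, dist (x i) (x j) ≤ m →
      ENNReal.ofReal (m ^ (-p)) ≤ 1 / edist (x i) (x j) ^ p := by
    intro i j hij
    rw [Real.rpow_neg hm.le, ENNReal.ofReal_inv_of_pos (by positivity),
      ← ENNReal.ofReal_rpow_of_pos hm, one_div, ENNReal.inv_le_inv, edist_dist]
    exact ENNReal.rpow_le_rpow (ENNReal.ofReal_le_ofReal hij) hp.le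
  unfold minDistance at h
  rw [min_le_iff, min_le_iff] at h
  unfold rieszEnergy
  rcases h with h | h | h
  · exact (key _ _ h).trans (le_self_add.trans le_self_add)
  · exact (key _ _ h).trans (le_add_self.trans le_self_add)
  · exact (key _ _ h).trans le_add_self

/-- For large `p`, a configuration of minimal distance bounded away from the one of `T3` has a
larger energy than `T3`: a single pair contributes `m⁻ᵖ`, which exceeds three times
`(√(2 c₃))⁻ᵖ`. -/
theorem exists_forall_not_isGlobalMinimizer {m : ℝ} (hm : m < √(2 * c₃)) :
    ∃ p₀ : ℝ, 0 < p₀ ∧ ∀ p, p₀ ≤ p → ∀ x : Config, minDistance x ≤ m → ¬ IsGlobalMinimizer p x := by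
  have hd : 0 < √(2 * c₃) := Real.sqrt_pos.2 (by linarith [lt_c₃])
  obtain ⟨m', hm', hmd⟩ := exists_between (max_lt hm hd)
  have hm0 : 0 < m' := (le_max_right _ _).trans_lt hm'
  have ev := (tendsto_rpow_atTop_of_base_gt_one (√(2 * c₃) / m')
    ((one_lt_div hm0).2 hmd)).eventually_gt_atTop 3
  obtain ⟨p₀, hp₀⟩ := Filter.eventually_atTop.1 ev
  refine ⟨max p₀ 1, by positivity, fun p hp x hx hmin => ?_⟩
  have hp0 : 0 < p := one_pos.trans_le ((le_max_right _ _).trans hp)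
  have h := hp₀ p ((le_max_left _ _).trans hp)
  have le := (le_rieszEnergy hp0 hm0 (hx.trans ((le_max_left _ _).trans hm'.le))).trans (hmin T3)
  rw [rieszEnergy_T3, ENNReal.ofReal_le_ofReal_iff (by positivity), Real.rpow_neg hm0.le,
    Real.rpow_neg hd.le, ← div_eq_mul_inv, inv_eq_one_div,
    div_le_div_iff₀ (by positivity) (by positivity)] at le
  rw [Real.div_rpow hd.le hm0.le, lt_div_iff₀ (by positivity)] at h
  linarith

theorem minDistance_le (x : Config) : minDistance x ≤ √(2 * c₃) := by
  by_contra! h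
  -- a configuration beating `T3` is symmetric to `T3`, so its distances are those of `T3`
  obtain ⟨g, σ, hx⟩ := symmEquiv_T3_of_le_minDistance h.le
  have hlt : √(2 * c₃) < dist (x 0) (x 1) := h.trans_le (min_le_left _ _)
  rw [hx, hx, g.isometry.dist_eq] at hlt
  obtain ⟨e₁, e₂, e₃⟩ := dist_T3
  rcases perm_fin_three σ with ⟨a, b, c⟩ | ⟨a, b, c⟩ | ⟨a, b, c⟩ | ⟨a, b, c⟩ | ⟨a, b, c⟩ |
    ⟨a, b, c⟩ <;> rw [a, b] at hlt <;> first | linarith | (rw [dist_comm] at hlt; linarith)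

theorem exists_close_to_T3 {ε : ℝ} (hε : 0 < ε) : ∃ p₀ : ℝ, 0 < p₀ ∧ ∀ p : ℝ, p₀ ≤ p →
    ∀ x : Config, IsGlobalMinimizer p x →
      ∃ t : Config, SymmEquiv T3 t ∧ ∀ i, dist (x i) (t i) < ε := by
  set K : Set Config := {x | ¬ ∃ t : Config, SymmEquiv T3 t ∧ ∀ i, dist (x i) (t i) < ε} with hK
  have hclosed : IsClosed K := by
    rw [← isOpen_compl_iff]
    have : Kᶜ = ⋃ t ∈ {t | SymmEquiv T3 t}, ⋂ i, {x : Config | dist (x i) (t i) < ε} := by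
      ext x; simp [hK]
    rw [this]
    refine isOpen_biUnion fun t _ => isOpen_iInter_of_finite fun i => ?_
    exact isOpen_lt ((continuous_apply i).dist continuous_const) continuous_const
  obtain ⟨m, hm, hmK⟩ : ∃ m < √(2 * c₃), ∀ x ∈ K, minDistance x ≤ m := by
    rcases K.eq_empty_or_nonempty with hempty | hne
    · exact ⟨√(2 * c₃) - 1, by linarith, fun x hx => by simp [hempty] at hx⟩
    · obtain ⟨y, hy, hmax⟩ :=
        hclosed.isCompact.exists_isMaxOn hne continuous_minDistance.continuousOn
      refine ⟨minDistance y, lt_of_not_ge fun h => hy ?_, fun x hx => hmax hx⟩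
      exact ⟨y, symmEquiv_T3_of_le_minDistance h, fun i => by simpa using hε⟩
  obtain ⟨p₀, hp₀, H⟩ := exists_forall_not_isGlobalMinimizer hm
  refine ⟨p₀, hp₀, fun p hp x hx => ?_⟩
  by_contra hcon
  exact H p hp x (hmK x hcon) hx

theorem not_symmEquiv_T3 {p : ℝ} (hp : 0 < p) {x : Config} (hx : IsGlobalMinimizer p x) :
    ¬ SymmEquiv T3 x :=
  fun h => not_isGlobalMinimizer_T3 hp (hx.of_symmEquiv h)

theorem exists_bound (x : Config) : ∃ P : ℝ, ∀ p, 0 < p → IsGlobalMinimizer p x → p ≤ P := by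
  by_cases h : SymmEquiv T3 x
  · exact ⟨0, fun p hp hx => absurd h (not_symmEquiv_T3 hp hx)⟩
  · have hlt : minDistance x < √(2 * c₃) := lt_of_not_ge fun h' =>
      h (symmEquiv_T3_of_le_minDistance h')
    obtain ⟨p₀, -, H⟩ := exists_forall_not_isGlobalMinimizer hlt
    refine ⟨p₀, fun p _ hx => ?_⟩
    by_contra! hp
    exact H p hp.le x le_rfl hx

/-- If the minimizers formed finitely many classes, the largest of the bounds for these classes
would bound all exponents, although every exponent has a minimizer. -/
theorem infinite_minimizers : Set.Infinite (Quotient.mk symmSetoid ''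
    {x : Config | ∃ p : ℝ, 0 < p ∧ IsGlobalMinimizer p x}) := by
  intro hfin
  choose P hP using exists_bound
  obtain ⟨M, hM⟩ := (hfin.image fun q => P q.out).bddAbove
  obtain ⟨x, hx⟩ := exists_isGlobalMinimizer (max M 0 + 1)
  have hp : 0 < max M 0 + 1 := by positivity
  have hmem : P (Quotient.mk symmSetoid x).out ≤ M :=
    hM ⟨_, ⟨x, ⟨_, hp, hx⟩, rfl⟩, rfl⟩
  have hsymm : SymmEquiv (Quotient.mk symmSetoid x).out x :=
    Quotient.exact (s := symmSetoid) (Quotient.out_eq _)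
  have := hP _ _ hp (hx.of_symmEquiv hsymm)
  linarith [le_max_left M 0]

end FlatTorus

theorem theorem2 :
    -- `T₃` maximizes the minimal distance
    (∀ y : FlatTorus.Config, FlatTorus.minDistance y ≤ FlatTorus.minDistance FlatTorus.T3) ∧
    -- the minimum of the energy is attained for every `p > 0`
    (∀ p : ℝ, 0 < p → ∃ x : FlatTorus.Config, FlatTorus.IsGlobalMinimizer p x) ∧
    -- as `p → ∞`, all global minimizers get close to `T₃`, up to symmetries
    (∀ ε : ℝ, 0 < ε → ∃ p₀ : ℝ, 0 < p₀ ∧ ∀ p : ℝ, p₀ ≤ p →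
      ∀ x : FlatTorus.Config, FlatTorus.IsGlobalMinimizer p x →
        ∃ t : FlatTorus.Config, FlatTorus.SymmEquiv FlatTorus.T3 t ∧ ∀ i, dist (x i) (t i) < ε) ∧
    -- no global minimizer is equal to `T₃` up to symmetries
    (∀ p : ℝ, 0 < p → ∀ x : FlatTorus.Config, FlatTorus.IsGlobalMinimizer p x →
      ¬ FlatTorus.SymmEquiv FlatTorus.T3 x) ∧
    -- every configuration is optimal at most for the `p` in some bounded interval
    (∀ x : FlatTorus.Config, ∃ P : ℝ,
      {p : ℝ | 0 < p ∧ FlatTorus.IsGlobalMinimizer p x} ⊆ Set.Ioc 0 P) ∧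
    -- up to symmetries there are infinitely many global minimizers as `p` varies
    Set.Infinite (Quotient.mk FlatTorus.symmSetoid ''
      {x : FlatTorus.Config | ∃ p : ℝ, 0 < p ∧ FlatTorus.IsGlobalMinimizer p x}) := by
  refine ⟨fun y => ?_, fun p _ => FlatTorus.exists_isGlobalMinimizer p,
    fun ε hε => FlatTorus.exists_close_to_T3 hε, fun p hp x hx => FlatTorus.not_symmEquiv_T3 hp hx,
    fun x => ?_, FlatTorus.infinite_minimizers⟩
  · rw [FlatTorus.minDistance_T3]
    exact FlatTorus.minDistance_le y
  · obtain ⟨P, hP⟩ := FlatTorus.exists_bound x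
    exact ⟨P, fun p hp => ⟨hp.1, hP p hp.1 hp.2⟩⟩
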